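/- Let $\mathbf{S}^n$ be the space of real symmetric $n\times n$ matrices with inner product $\langle X,Y\rangle=\operatorname{tr}(XY)$, let $\lambda\colon\mathbf{S}^n\to\mathbb{R}^n$ map a matrix to the vector of its eigenvalues (with multiplicity) in nonincreasing order, and let $\mathbf{O}^n_X$ be the set of orthogonal matrices $U$ with $X=U^T(\operatorname{Diag}\lambda(X))U$. For a Euclidean space $\mathbf{E}$, a function $h\colon\mathbf{E}\to[-\infty,\infty]$ and a point $x$ with $h(x)$ finite, $\hat\partial h(x)$ is the set of $v\in\mathbf{E}$ with $h(y)\ge h(x)+\langle v,y-x\rangle+o(\|y-x\|)$ as $y\to x$, and $\partial h(x)$ is the set of $v$ for which there are sequences $x_i$ and $v_i\in\hat\partial h(x_i)$ with $(x_i,h(x_i),v_i)\to(x,h(x),v)$; both sets are empty if $h(x)$ is not finite. Put $\operatorname{dom}h=\{x: h(x)<+\infty\}$. A set $M\subset\operatorname{dom}h$ is identifiable (relative to $h$) at $x$ for $v\in\partial h(x)$ if, whenever $(x_i,h(x_i),v_i)\to(x,h(x),v)$ with $v_i\in\partial h(x_i)$, one has $x_i\in M$ for all large $i$. A function $f\colon\mathbb{R}^n\to[-\infty,\infty]$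 is locally symmetric at $\bar x$ if $f(x)=f(\sigma x)$ for all $x$ near $\bar x$ and all coordinate permutations $\sigma$ with $\sigma\bar x=\bar x$; a set is locally symmetric at $\bar x$ if its indicator function ($0$ on the set, $+\infty$ off it) is. **Proposition.** Let $f\colon\mathbb{R}^n\to[-\infty,\infty]$ be lower semicontinuous, let $\overline{X}\in\mathbf{S}^n$ and $\bar x=\lambda(\overline{X})$, and suppose that $f$ and a set $M\subset\operatorname{dom}f$ are locally symmetric at $\bar x$. Let $\bar v\in\partial f(\bar x)$ and $U\in\mathbf{O}^n_{\overline{X}}$. Then $U^T(\operatorname{Diag}\bar v)U\in\partial(f\circ\lambda)(\overline{X})$, and $M$ is identifiable (relative to $f$) at $\bar x$ for $\bar v$ if and only if $\lambda^{-1}(M)$ is identifiable (relative to $f\circ\lambda$) at $\overline{X}$ for $U^T(\operatorname{Diag}\bar v)U$. -/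

import Mathlib

open Filter Topology

namespace SpectralLift

noncomputable section

/-! Variational analysis on a Euclidean space `E` -/

section Variational

variable {E : Type*} [NormedAddCommGroup E] [InnerProductSpace ℝ E]

/-- The domain `{x | f x < +∞}`. -/
def dom (f : E → EReal) : Set E := {x | f x < ⊤}

/-- The indicator function of a set: `0` on the set and `+∞` outside of it. -/
def indicatorFun (Q : Set E) : E → EReal := by
  classical exact fun x => if x ∈ Q then 0 else ⊤

/-- The Fréchet subdifferential: `f x` is finite and
`f y ≥ f x + ⟨v, y - x⟩ + o(‖y - x‖)` as `y → x`. -/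
def frechetSubdiff (f : E → EReal) (x : E) : Set E :=
  {v | f x ≠ ⊥ ∧ f x ≠ ⊤ ∧ ∀ ε : ℝ, 0 < ε → ∀ᶠ y in 𝓝 x,
    f x + ((inner ℝ v (y - x) - ε * ‖y - x‖ : ℝ) : EReal) ≤ f y}

/-- The limiting subdifferential (at points where `f` is finite). -/
def limitingSubdiff (f : E → EReal) (x : E) : Set E :=
  {v | f x ≠ ⊥ ∧ f x ≠ ⊤ ∧ ∃ (xs : ℕ → E) (vs : ℕ → E),
    (∀ i, vs i ∈ frechetSubdiff f (xs i)) ∧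
    Tendsto xs atTop (𝓝 x) ∧
    Tendsto (fun i => f (xs i)) atTop (𝓝 (f x)) ∧
    Tendsto vs atTop (𝓝 v)}

/-- The set `M ⊆ dom f` is identifiable (relative to `f`) at `x` for the subgradient `v`. -/
def IsIdentifiable (f : E → EReal) (M : Set E) (x v : E) : Prop :=
  M ⊆ dom f ∧ v ∈ limitingSubdiff f x ∧
    ∀ (xs : ℕ → E) (vs : ℕ → E),
      (∀ i, vs i ∈ limitingSubdiff f (xs i)) →
      Tendsto xs atTop (𝓝 x) →
      Tendsto (fun i => f (xs i)) atTop (𝓝 (f x)) →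
      Tendsto vs atTop (𝓝 v) →
      ∀ᶠ i in atTop, xs i ∈ M

end Variational

/-! Local symmetry on `ℝⁿ` -/

/-- The permutation `σ` acting on the coordinates of a vector: `(σ x) i = x (σ⁻¹ i)`. -/
def permute {n : ℕ} (σ : Equiv.Perm (Fin n)) (x : EuclideanSpace ℝ (Fin n)) :
    EuclideanSpace ℝ (Fin n) :=
  WithLp.toLp 2 fun i => x (σ⁻¹ i)

/-- The stabilizer of `x` in the group of coordinate permutations. -/
def fix {n : ℕ} (x : EuclideanSpace ℝ (Fin n)) : Set (Equiv.Perm (Fin n)) :=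
  {σ | permute σ x = x}

/-- `f` is locally symmetric at `x₀`. -/
def LocallySymmetric {n : ℕ} (f : EuclideanSpace ℝ (Fin n) → EReal)
    (x₀ : EuclideanSpace ℝ (Fin n)) : Prop :=
  ∀ᶠ x in 𝓝 x₀, ∀ σ ∈ fix x₀, f x = f (permute σ x)

/-- A set is locally symmetric at `x₀` if its indicator function is. -/
def LocallySymmetricSet {n : ℕ} (Q : Set (EuclideanSpace ℝ (Fin n)))
    (x₀ : EuclideanSpace ℝ (Fin n)) : Prop :=
  LocallySymmetric (indicatorFun Q) x₀

/-! The Euclidean space of symmetric matrices -/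

/-- The subspace of symmetric matrices. -/
def symSubmodule (n : ℕ) : Submodule ℝ (Matrix (Fin n) (Fin n) ℝ) where
  carrier := {A | A.IsSymm}
  add_mem' := fun hA hB => Matrix.IsSymm.add hA hB
  zero_mem' := Matrix.isSymm_zero
  smul_mem' := fun c _ hA => Matrix.IsSymm.smul hA c

/-- The space of real symmetric `n × n` matrices. -/
abbrev SymMat (n : ℕ) : Type := symSubmodule n

/-- The Frobenius norm on symmetric matrices. -/
instance instNormedAddCommGroupSymMat (n : ℕ) : NormedAddCommGroup (SymMat n) :=
  letI : NormedAddCommGroup (Matrix (Fin n) (Fin n) ℝ) := Matrix.frobeniusNormedAddCommGroup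
  letI : NormedSpace ℝ (Matrix (Fin n) (Fin n) ℝ) := Matrix.frobeniusNormedSpace
  Submodule.normedAddCommGroup (symSubmodule n)

instance instNormedSpaceSymMat (n : ℕ) : NormedSpace ℝ (SymMat n) :=
  letI : NormedAddCommGroup (Matrix (Fin n) (Fin n) ℝ) := Matrix.frobeniusNormedAddCommGroup
  letI : NormedSpace ℝ (Matrix (Fin n) (Fin n) ℝ) := Matrix.frobeniusNormedSpace
  Submodule.normedSpace (symSubmodule n)

theorem norm_sq_symMat {n : ℕ} (X : SymMat n) :
    ‖X‖ ^ 2 = ((X : Matrix (Fin n) (Fin n) ℝ) * (X : Matrix (Fin n) (Fin n) ℝ)).trace := by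
  let _ : NormedAddCommGroup (Matrix (Fin n) (Fin n) ℝ) := Matrix.frobeniusNormedAddCommGroup
  have h1 : ‖X‖ = ‖(X : Matrix (Fin n) (Fin n) ℝ)‖ := rfl
  have h0 : (0 : ℝ) ≤ ∑ i, ∑ j, ‖(X : Matrix (Fin n) (Fin n) ℝ) i j‖ ^ (2 : ℝ) := by positivity
  rw [h1, Matrix.frobenius_norm_def, ← Real.sqrt_eq_rpow, Real.sq_sqrt h0]
  have hs : (X : Matrix (Fin n) (Fin n) ℝ).IsSymm := X.2
  simp only [Matrix.trace, Matrix.diag, Matrix.mul_apply]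
  refine Finset.sum_congr rfl fun i _ => Finset.sum_congr rfl fun j _ => ?_
  rw [hs.apply i j, Real.rpow_two, Real.norm_eq_abs, sq_abs, sq]

/-- The trace inner product `⟨X, Y⟩ = tr (X Y)`. -/
instance instInnerProductSpaceSymMat (n : ℕ) : InnerProductSpace ℝ (SymMat n) where
  inner X Y := ((X : Matrix (Fin n) (Fin n) ℝ) * (Y : Matrix (Fin n) (Fin n) ℝ)).trace
  norm_sq_eq_re_inner X := norm_sq_symMat X
  conj_inner_symm X Y := by
    simpa using Matrix.trace_mul_comm (Y : Matrix (Fin n) (Fin n) ℝ) X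
  add_left X Y Z := by simp [add_mul]
  smul_left X Y r := by simp

/-! Spectral notions -/

theorem SymMat.isHermitian {n : ℕ} (X : SymMat n) :
    (X : Matrix (Fin n) (Fin n) ℝ).IsHermitian := by
  rw [Matrix.IsHermitian, Matrix.conjTranspose_eq_transpose_of_trivial]
  exact X.2

/-- The spectral map: the eigenvalues with multiplicity, in nonincreasing order. -/
def lam {n : ℕ} (X : SymMat n) : EuclideanSpace ℝ (Fin n) :=
  WithLp.toLp 2 fun i => X.isHermitian.eigenvalues₀ (Fin.cast (Fintype.card_fin n).symm i)

/-- `Uᵀ (Diag v) U` as a symmetric matrix. -/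
def conjDiag {n : ℕ} (U : Matrix (Fin n) (Fin n) ℝ) (v : EuclideanSpace ℝ (Fin n)) : SymMat n :=
  ⟨U.transpose * Matrix.diagonal (fun i => v i) * U, by
    change Matrix.IsSymm _
    simp [Matrix.IsSymm, Matrix.transpose_mul, Matrix.mul_assoc]⟩

/-- The orthogonal matrices `U` with `X = Uᵀ (Diag (λ X)) U`. -/
def diagonalizers {n : ℕ} (X : SymMat n) : Set (Matrix (Fin n) (Fin n) ℝ) :=
  {U | U ∈ Matrix.orthogonalGroup (Fin n) ℝ ∧ X = conjDiag U (lam X)}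

end

end SpectralLift

/-! Everything rests on the subdifferential formula for spectral functions: when `f` is locally
symmetric at `lam X`, the limiting subgradients of `f ∘ lam` at `X` are exactly the `conjDiag U v`
with `U ∈ diagonalizers X` and `v ∈ limitingSubdiff f (lam X)` (`conjDiag_mem_limitingSubdiff`,
`exists_conjDiag_of_mem_limitingSubdiff`). The Fréchet version comes from von Neumann's trace
inequality `inner_le_inner_lam`, applied at the perturbed matrix `X + t • V`; limits then use
continuity of `lam` and compactness of the orthogonal group.

Identifiability is transferred by moving test sequences. A vector sequence becomes a matrix sequence
by conjugating with the fixed `U`; its spectra are permutations of the vectors, by permutations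
fixing `lam X`. A matrix sequence has varying diagonalizers, which converge along a subsequence to
some `W₀`. The limit pairs seen through `W₀` and `U` agree up to one permutation fixing `lam X`
(`exists_permute_of_conjDiag_eq`), and local symmetry of `f` and `M` absorbs it. -/

namespace SpectralLift

open Matrix

/-! ### Diagonalization, von Neumann's trace inequality, and the Lipschitz bound for `lam`. -/

section Spectral

variable {n : ℕ}

theorem coe_conjDiag (U : Matrix (Fin n) (Fin n) ℝ) (v : EuclideanSpace ℝ (Fin n)) :
    (conjDiag U v : Matrix (Fin n) (Fin n) ℝ) = Uᵀ * diagonal (fun i => v i) * U := rfl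

theorem conjDiag_apply (U : Matrix (Fin n) (Fin n) ℝ) (v : EuclideanSpace ℝ (Fin n))
    (i j : Fin n) :
    (conjDiag U v : Matrix (Fin n) (Fin n) ℝ) i j = ∑ k, U k i * v k * U k j := by
  rw [coe_conjDiag, mul_apply]
  simp only [mul_diagonal, transpose_apply]

theorem transpose_mul_self_of_mem {U : Matrix (Fin n) (Fin n) ℝ}
    (hU : U ∈ orthogonalGroup (Fin n) ℝ) : Uᵀ * U = 1 := by
  simpa [star_eq_conjTranspose] using (mem_orthogonalGroup_iff' (Fin n) ℝ).1 hU

theorem mul_transpose_self_of_mem {U : Matrix (Fin n) (Fin n) ℝ}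
    (hU : U ∈ orthogonalGroup (Fin n) ℝ) : U * Uᵀ = 1 := by
  simpa [star_eq_conjTranspose] using (mem_orthogonalGroup_iff (Fin n) ℝ).1 hU

theorem mem_orthogonalGroup_of_mul_transpose {U : Matrix (Fin n) (Fin n) ℝ}
    (hU : U * Uᵀ = 1) : U ∈ orthogonalGroup (Fin n) ℝ :=
  (mem_orthogonalGroup_iff (Fin n) ℝ).2 (by simpa [star_eq_conjTranspose] using hU)

theorem conjDiag_add (U : Matrix (Fin n) (Fin n) ℝ) (v w : EuclideanSpace ℝ (Fin n)) :
    conjDiag U (v + w) = conjDiag U v + conjDiag U w := by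
  apply Subtype.ext
  simp [coe_conjDiag, ← diagonal_add, mul_add, add_mul]

theorem conjDiag_smul (U : Matrix (Fin n) (Fin n) ℝ) (c : ℝ) (v : EuclideanSpace ℝ (Fin n)) :
    conjDiag U (c • v) = c • conjDiag U v := by
  apply Subtype.ext
  have : (diagonal fun i => c * v i) = c • diagonal (fun i => v i) := by
    ext i j; simp [diagonal_apply]
  simp [coe_conjDiag, this]

theorem conjDiag_sub (U : Matrix (Fin n) (Fin n) ℝ) (v w : EuclideanSpace ℝ (Fin n)) :
    conjDiag U (v - w) = conjDiag U v - conjDiag U w := by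
  rw [eq_sub_iff_add_eq, ← conjDiag_add, sub_add_cancel]

theorem inner_conjDiag {U : Matrix (Fin n) (Fin n) ℝ} (hU : U ∈ orthogonalGroup (Fin n) ℝ)
    (v w : EuclideanSpace ℝ (Fin n)) :
    inner ℝ (conjDiag U v) (conjDiag U w) = inner ℝ v w := by
  change trace ((Uᵀ * diagonal (fun i => v i) * U) * (Uᵀ * diagonal (fun i => w i) * U)) = _
  have : (Uᵀ * diagonal (fun i => v i) * U) * (Uᵀ * diagonal (fun i => w i) * U)
      = Uᵀ * (diagonal (fun i => v i) * (U * Uᵀ) * diagonal (fun i => w i) * U) := by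
    simp only [Matrix.mul_assoc]
  rw [this, trace_mul_comm, mul_transpose_self_of_mem hU, Matrix.mul_one, Matrix.mul_assoc,
    mul_transpose_self_of_mem hU, Matrix.mul_one, diagonal_mul_diagonal]
  simp [trace, PiLp.inner_apply, mul_comm]

theorem norm_conjDiag {U : Matrix (Fin n) (Fin n) ℝ} (hU : U ∈ orthogonalGroup (Fin n) ℝ)
    (v : EuclideanSpace ℝ (Fin n)) : ‖conjDiag U v‖ = ‖v‖ := by
  rw [norm_eq_sqrt_real_inner, norm_eq_sqrt_real_inner, inner_conjDiag hU]

/-- The coordinate permutation as a linear isometry. -/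
noncomputable def permuteEquiv (σ : Equiv.Perm (Fin n)) :
    EuclideanSpace ℝ (Fin n) ≃ₗᵢ[ℝ] EuclideanSpace ℝ (Fin n) :=
  LinearIsometryEquiv.piLpCongrLeft 2 ℝ ℝ σ

theorem permuteEquiv_apply (σ : Equiv.Perm (Fin n)) (x : EuclideanSpace ℝ (Fin n)) :
    permuteEquiv σ x = permute σ x := by
  ext i
  simp [permuteEquiv, permute, Equiv.piCongrLeft']

theorem permute_apply (σ : Equiv.Perm (Fin n)) (x : EuclideanSpace ℝ (Fin n)) (i : Fin n) :
    permute σ x i = x (σ⁻¹ i) := rfl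

theorem permute_add (σ : Equiv.Perm (Fin n)) (x y : EuclideanSpace ℝ (Fin n)) :
    permute σ (x + y) = permute σ x + permute σ y := rfl

theorem permute_sub (σ : Equiv.Perm (Fin n)) (x y : EuclideanSpace ℝ (Fin n)) :
    permute σ (x - y) = permute σ x - permute σ y := rfl

theorem permute_smul (σ : Equiv.Perm (Fin n)) (c : ℝ) (x : EuclideanSpace ℝ (Fin n)) :
    permute σ (c • x) = c • permute σ x := rfl

theorem norm_permute (σ : Equiv.Perm (Fin n)) (x : EuclideanSpace ℝ (Fin n)) :
    ‖permute σ x‖ = ‖x‖ := by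
  rw [← permuteEquiv_apply, LinearIsometryEquiv.norm_map]

theorem submatrix_mem_orthogonalGroup {U : Matrix (Fin n) (Fin n) ℝ}
    (hU : U ∈ orthogonalGroup (Fin n) ℝ) (σ : Equiv.Perm (Fin n)) :
    U.submatrix (σ⁻¹ : Equiv.Perm (Fin n)) id ∈ orthogonalGroup (Fin n) ℝ := by
  apply mem_orthogonalGroup_of_mul_transpose
  rw [transpose_submatrix, submatrix_mul _ _ _ id _ Function.bijective_id |>.symm,
    mul_transpose_self_of_mem hU]
  exact submatrix_one_equiv _

/-- Permuting the rows of `U` along with the coordinates only reorders a sum; this is how an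
unsorted diagonal is brought into nonincreasing order. -/
theorem conjDiag_submatrix (U : Matrix (Fin n) (Fin n) ℝ) (σ : Equiv.Perm (Fin n))
    (x : EuclideanSpace ℝ (Fin n)) :
    conjDiag (U.submatrix (σ⁻¹ : Equiv.Perm (Fin n)) id) (permute σ x) = conjDiag U x := by
  apply Subtype.ext
  ext i j
  rw [conjDiag_apply, conjDiag_apply]
  exact Equiv.sum_comp (σ⁻¹ : Equiv.Perm (Fin n)) fun k => U k i * x k * U k j

theorem exists_antitone_permute (x : EuclideanSpace ℝ (Fin n)) :
    ∃ σ : Equiv.Perm (Fin n), Antitone (permute σ x) := by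
  refine ⟨(Tuple.sort fun i => -x i)⁻¹, fun i j hij => ?_⟩
  simpa only [permute_apply, inv_inv, Function.comp_apply, neg_le_neg_iff] using
    Tuple.monotone_sort (fun i => -x i) hij

theorem antitone_lam (X : SymMat n) : Antitone (lam X) := fun _ _ hij =>
  X.isHermitian.eigenvalues₀_antitone (by simpa using hij)

theorem charpoly_conjDiag {U : Matrix (Fin n) (Fin n) ℝ} (hU : U ∈ orthogonalGroup (Fin n) ℝ)
    (a : EuclideanSpace ℝ (Fin n)) :
    (conjDiag U a : Matrix (Fin n) (Fin n) ℝ).charpoly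
      = (diagonal fun i => a i : Matrix (Fin n) (Fin n) ℝ).charpoly := by
  rw [coe_conjDiag, Matrix.mul_assoc, charpoly_mul_comm, Matrix.mul_assoc,
    mul_transpose_self_of_mem hU, Matrix.mul_one]

/-- Conjugation keeps the characteristic polynomial, and its multiset of roots has only one
nonincreasing listing. -/
theorem lam_conjDiag {U : Matrix (Fin n) (Fin n) ℝ} (hU : U ∈ orthogonalGroup (Fin n) ℝ)
    {a : EuclideanSpace ℝ (Fin n)} (ha : Antitone a) : lam (conjDiag U a) = a := by
  have h1 := (conjDiag U a).isHermitian.sort_roots_charpoly_eq_eigenvalues₀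
  have h2 : List.ofFn (conjDiag U a).isHermitian.eigenvalues₀
      = List.ofFn fun i => lam (conjDiag U a) i :=
    List.ofFn_congr (Fintype.card_fin n) _
  have h3 : (conjDiag U a : Matrix (Fin n) (Fin n) ℝ).charpoly.roots
      = Multiset.map (fun i => a i) Finset.univ.val := by
    rw [charpoly_conjDiag hU, charpoly_diagonal]
    have h := Polynomial.roots_multiset_prod_X_sub_C (Finset.univ.val.map fun i => a i)
    rwa [Multiset.map_map] at h
  rw [h2, h3] at h1
  have h4 : (List.ofFn fun i => a i) = List.ofFn fun i => lam (conjDiag U a) i := by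
    rw [← h1]
    refine List.Perm.eq_of_sortedGE ha.sortedGE_ofFn ?_ ?_
    · exact (Multiset.pairwise_sort _ _).sortedGE
    · rw [← Multiset.coe_eq_coe, Multiset.sort_eq]
      simp [Fin.univ_val_map, Function.comp_def]
  ext i
  exact (congrFun (List.ofFn_injective h4) i).symm

theorem lam_conjDiag_and_mem_diagonalizers {U : Matrix (Fin n) (Fin n) ℝ}
    (hU : U ∈ orthogonalGroup (Fin n) ℝ) {σ : Equiv.Perm (Fin n)} {a : EuclideanSpace ℝ (Fin n)}
    (h : Antitone (permute σ a)) :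
    lam (conjDiag U a) = permute σ a ∧
      U.submatrix (σ⁻¹ : Equiv.Perm (Fin n)) id ∈ diagonalizers (conjDiag U a) := by
  have h1 : lam (conjDiag U a) = permute σ a := by
    rw [← conjDiag_submatrix U σ, lam_conjDiag (submatrix_mem_orthogonalGroup hU σ) h]
  exact ⟨h1, submatrix_mem_orthogonalGroup hU σ, by rw [h1, conjDiag_submatrix]⟩

/-- The spectral theorem supplies `eigenvalues`, which need not be sorted as `lam` is, so the rows
of the eigenbasis are permuted afterwards. -/
theorem diagonalizers_nonempty (X : SymMat n) : (diagonalizers X).Nonempty := by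
  obtain ⟨U, hU, a, rfl⟩ : ∃ U ∈ orthogonalGroup (Fin n) ℝ, ∃ a, X = conjDiag U a := by
    refine ⟨star (X.isHermitian.eigenvectorUnitary : Matrix (Fin n) (Fin n) ℝ),
      Unitary.star_mem X.isHermitian.eigenvectorUnitary.2,
      WithLp.toLp 2 X.isHermitian.eigenvalues, Subtype.ext ?_⟩
    conv_lhs => rw [X.isHermitian.spectral_theorem]
    rw [coe_conjDiag, Unitary.conjStarAlgAut_apply, star_eq_conjTranspose,
      conjTranspose_eq_transpose_of_trivial, transpose_transpose]
    rfl
  obtain ⟨σ, hσ⟩ := exists_antitone_permute a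
  exact ⟨_, (lam_conjDiag_and_mem_diagonalizers hU hσ).2⟩

/-- The entrywise square of an orthogonal matrix is doubly stochastic. -/
theorem sq_mem_doublyStochastic {W : Matrix (Fin n) (Fin n) ℝ}
    (hW : W ∈ orthogonalGroup (Fin n) ℝ) :
    (of fun i j => W i j ^ 2) ∈ doublyStochastic ℝ (Fin n) := by
  rw [mem_doublyStochastic_iff_sum]
  refine ⟨fun i j => sq_nonneg _, fun i => ?_, fun j => ?_⟩
  · have := congrFun (congrFun (mul_transpose_self_of_mem hW) i) i
    simpa [mul_apply, sq] using this
  · have := congrFun (congrFun (transpose_mul_self_of_mem hW) j) j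
    simpa [mul_apply, sq] using this

/-- By Birkhoff's theorem it suffices to treat permutation matrices, where this is the rearrangement
inequality. -/
theorem sum_mul_le_of_mem_doublyStochastic {S : Matrix (Fin n) (Fin n) ℝ}
    (hS : S ∈ doublyStochastic ℝ (Fin n)) {a b : Fin n → ℝ} (ha : Antitone a)
    (hb : Antitone b) : ∑ i, ∑ j, S i j * (a i * b j) ≤ ∑ i, a i * b i := by
  obtain ⟨w, hw0, hw1, rfl⟩ := exists_eq_sum_perm_of_mem_doublyStochastic hS
  have key : ∀ σ : Equiv.Perm (Fin n),
      ∑ i, ∑ j, (σ.permMatrix ℝ) i j * (a i * b j) ≤ ∑ i, a i * b i := by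
    intro σ
    have : ∀ i, ∑ j, (σ.permMatrix ℝ) i j * (a i * b j) = a i * b (σ i) := by
      intro i
      simp [Equiv.Perm.permMatrix, PEquiv.toMatrix_apply]
    simp only [this]
    exact (ha.monovary hb).sum_mul_comp_perm_le_sum_mul
  calc ∑ i, ∑ j, (∑ σ, w σ • σ.permMatrix ℝ) i j * (a i * b j)
      = ∑ σ, w σ * ∑ i, ∑ j, (σ.permMatrix ℝ) i j * (a i * b j) := by
        simp only [Matrix.sum_apply, Matrix.smul_apply, smul_eq_mul, Finset.sum_mul,
          Finset.mul_sum, mul_assoc]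
        rw [Finset.sum_comm (s := (Finset.univ : Finset (Equiv.Perm (Fin n))))]
        exact Finset.sum_congr rfl fun i _ => Finset.sum_comm
    _ ≤ ∑ σ, w σ * ∑ i, a i * b i :=
        Finset.sum_le_sum fun σ _ => mul_le_mul_of_nonneg_left (key σ) (hw0 σ)
    _ = ∑ i, a i * b i := by rw [← Finset.sum_mul, hw1, one_mul]

/-- Von Neumann's trace inequality for symmetric matrices. -/
theorem inner_le_inner_lam (A B : SymMat n) : inner ℝ A B ≤ inner ℝ (lam A) (lam B) := by
  obtain ⟨U, hU, hA⟩ := diagonalizers_nonempty A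
  obtain ⟨V, hV, hB⟩ := diagonalizers_nonempty B
  have hW : U * Vᵀ ∈ orthogonalGroup (Fin n) ℝ := by
    apply mem_orthogonalGroup_of_mul_transpose
    rw [transpose_mul, transpose_transpose, Matrix.mul_assoc, ← Matrix.mul_assoc Vᵀ,
      transpose_mul_self_of_mem hV, Matrix.one_mul, mul_transpose_self_of_mem hU]
  have h := sum_mul_le_of_mem_doublyStochastic (sq_mem_doublyStochastic hW) (antitone_lam A)
    (antitone_lam B)
  -- The trace is a bilinear form in the two spectra whose weights are the squared entries of `U *
  -- Vᵀ`.
  have e1 : inner ℝ A B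
      = ∑ i, ∑ j, (of fun i j => (U * Vᵀ) i j ^ 2) i j * (lam A i * lam B j) := by
    conv_lhs => rw [hA, hB]
    set W := U * Vᵀ with hWdef
    change trace ((Uᵀ * diagonal (fun i => lam A i) * U) *
      (Vᵀ * diagonal (fun i => lam B i) * V)) = _
    have : (Uᵀ * diagonal (fun i => lam A i) * U) * (Vᵀ * diagonal (fun i => lam B i) * V)
      = Uᵀ * (diagonal (fun i => lam A i) * (U * Vᵀ) * diagonal (fun i => lam B i) * V) := by
      simp only [Matrix.mul_assoc]
    have hT : V * Uᵀ = Wᵀ := by rw [hWdef, transpose_mul, transpose_transpose]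
    rw [this, trace_mul_comm, Matrix.mul_assoc, hT, ← hWdef]
    refine Finset.sum_congr rfl fun i _ => ?_
    rw [diag_apply, mul_apply]
    refine Finset.sum_congr rfl fun j _ => ?_
    rw [mul_diagonal, diagonal_mul, transpose_apply, of_apply]
    ring
  rw [e1]
  refine h.trans_eq ?_
  simp [PiLp.inner_apply, mul_comm]

theorem norm_lam (X : SymMat n) : ‖lam X‖ = ‖X‖ := by
  obtain ⟨U, hU, hX⟩ := diagonalizers_nonempty X
  conv_rhs => rw [hX, norm_conjDiag hU]

/-- Since `lam` preserves norms, expanding both squares reduces this to the trace inequality. -/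
theorem norm_lam_sub_lam_le (A B : SymMat n) : ‖lam A - lam B‖ ≤ ‖A - B‖ := by
  refine (sq_le_sq₀ (norm_nonneg _) (norm_nonneg _)).1 ?_
  rw [norm_sub_sq_real, norm_sub_sq_real, norm_lam, norm_lam]
  linarith [inner_le_inner_lam A B]

theorem continuous_lam : Continuous (lam : SymMat n → EuclideanSpace ℝ (Fin n)) := by
  refine (LipschitzWith.of_dist_le_mul (K := 1) fun A B => ?_).continuous
  simpa [dist_eq_norm] using norm_lam_sub_lam_le A B

end Spectral

/-! ### Subgradients under isometries, and sequences constrained only eventually. -/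

section Variational

variable {E : Type*} [NormedAddCommGroup E] [InnerProductSpace ℝ E]

theorem map_mem_frechetSubdiff (L : E ≃ₗᵢ[ℝ] E) {f : E → EReal} {x v : E}
    (h : ∀ᶠ y in 𝓝 x, f y = f (L y)) (hv : v ∈ frechetSubdiff f x) :
    L v ∈ frechetSubdiff f (L x) := by
  obtain ⟨hb, ht, hε⟩ := hv
  have hx := h.self_of_nhds
  refine ⟨hx ▸ hb, hx ▸ ht, fun ε hε0 => ?_⟩
  have hL : Tendsto L.symm (𝓝 (L x)) (𝓝 x) := by
    simpa using L.symm.continuous.tendsto (L x)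
  filter_upwards [hL.eventually h, hL.eventually (hε ε hε0)] with y h1 h2
  rw [L.apply_symm_apply] at h1
  rw [← hx, ← h1]
  have e : y - L x = L (L.symm y - x) := by simp
  rwa [e, L.inner_map_map, L.norm_map]

theorem mem_limitingSubdiff_of_eventually {f : E → EReal} {x v : E} (hb : f x ≠ ⊥) (ht : f x ≠ ⊤)
    {xs vs : ℕ → E} (h : ∀ᶠ i in atTop, vs i ∈ frechetSubdiff f (xs i))
    (hx : Tendsto xs atTop (𝓝 x)) (hfx : Tendsto (fun i => f (xs i)) atTop (𝓝 (f x)))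
    (hv : Tendsto vs atTop (𝓝 v)) : v ∈ limitingSubdiff f x := by
  obtain ⟨N, hN⟩ := eventually_atTop.1 h
  exact ⟨hb, ht, fun i => xs (i + N), fun i => vs (i + N), fun i => hN _ (Nat.le_add_left _ _),
    (tendsto_add_atTop_iff_nat N).2 hx,
    (tendsto_add_atTop_iff_nat (f := fun i => f (xs i)) N).2 hfx,
    (tendsto_add_atTop_iff_nat N).2 hv⟩

theorem map_mem_limitingSubdiff (L : E ≃ₗᵢ[ℝ] E) {f : E → EReal} {x v : E}
    (h : ∀ᶠ y in 𝓝 x, f y = f (L y)) (hv : v ∈ limitingSubdiff f x) :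
    L v ∈ limitingSubdiff f (L x) := by
  obtain ⟨hb, ht, xs, vs, hF, hxs, hfxs, hvs⟩ := hv
  have hx := h.self_of_nhds
  refine mem_limitingSubdiff_of_eventually (xs := fun i => L (xs i)) (vs := fun i => L (vs i))
    (hx ▸ hb) (hx ▸ ht) ?_ ((L.continuous.tendsto x).comp hxs) ?_
    ((L.continuous.tendsto v).comp hvs)
  · filter_upwards [hxs.eventually h.eventually_nhds] with i hi
    exact map_mem_frechetSubdiff L hi (hF i)
  · rw [← hx]
    refine hfxs.congr' ?_
    filter_upwards [hxs.eventually h] with i hi using hi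

theorem IsIdentifiable.eventually_mem {f : E → EReal} {M : Set E} {x v : E}
    (h : IsIdentifiable f M x v) {xs vs : ℕ → E}
    (hF : ∀ᶠ i in atTop, vs i ∈ limitingSubdiff f (xs i))
    (hx : Tendsto xs atTop (𝓝 x)) (hfx : Tendsto (fun i => f (xs i)) atTop (𝓝 (f x)))
    (hv : Tendsto vs atTop (𝓝 v)) : ∀ᶠ i in atTop, xs i ∈ M := by
  obtain ⟨N, hN⟩ := eventually_atTop.1 hF
  have h' := h.2.2 (fun i => xs (i + N)) (fun i => vs (i + N))
    (fun i => hN _ (Nat.le_add_left _ _)) ((tendsto_add_atTop_iff_nat N).2 hx)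
    ((tendsto_add_atTop_iff_nat (f := fun i => f (xs i)) N).2 hfx)
    ((tendsto_add_atTop_iff_nat N).2 hv)
  obtain ⟨K, hK⟩ := eventually_atTop.1 h'
  refine eventually_atTop.2 ⟨K + N, fun i hi => ?_⟩
  have := hK (i - N) (by omega)
  rwa [Nat.sub_add_cancel (by omega)] at this

end Variational

/-! ### Stabilizers and local symmetry near the base point. -/

section LocalSymmetry

variable {n : ℕ}

theorem continuous_permute (σ : Equiv.Perm (Fin n)) : Continuous (permute σ) := by
  have : permute σ = permuteEquiv σ := funext fun x => (permuteEquiv_apply σ x).symm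
  rw [this]
  exact (permuteEquiv σ).continuous

theorem eventually_fix_subset (x : EuclideanSpace ℝ (Fin n)) : ∀ᶠ y in 𝓝 x, fix y ⊆ fix x := by
  have h : ∀ᶠ y in 𝓝 x, ∀ σ : Equiv.Perm (Fin n), permute σ y = y → permute σ x = x := by
    refine eventually_all.2 fun σ => ?_
    by_cases hσ : permute σ x = x
    · exact Eventually.of_forall fun _ _ => hσ
    · filter_upwards [(isOpen_ne_fun (continuous_permute σ) continuous_id).mem_nhds
        hσ] with y hy h using absurd h hy
  exact h

/-- Stabilizers can only shrink at nearby points, so the Fréchet results become available along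
sequences tending to `x`. -/
theorem LocallySymmetric.eventually {f : EuclideanSpace ℝ (Fin n) → EReal}
    {x : EuclideanSpace ℝ (Fin n)} (h : LocallySymmetric f x) :
    ∀ᶠ y in 𝓝 x, LocallySymmetric f y := by
  filter_upwards [Eventually.eventually_nhds h, eventually_fix_subset x] with y hy hs
  filter_upwards [hy] with z hz σ hσ using hz σ (hs hσ)

theorem LocallySymmetricSet.eventually_mem_iff {Q : Set (EuclideanSpace ℝ (Fin n))}
    {x : EuclideanSpace ℝ (Fin n)} (h : LocallySymmetricSet Q x) :
    ∀ᶠ y in 𝓝 x, ∀ σ ∈ fix x, (permute σ y ∈ Q ↔ y ∈ Q) := by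
  filter_upwards [h] with y hy σ hσ
  have := hy σ hσ
  by_cases h1 : y ∈ Q <;> by_cases h2 : permute σ y ∈ Q <;> simp_all [indicatorFun]

/-- Sorting is 1-Lipschitz, being `lam` on diagonal matrices. If `σ` sorts `y`, then `permute σ y`
is within `‖y - x‖` of both `x` and `permute σ x`, so a `σ` moving `x` is excluded once `y` is close
enough; there are finitely many `σ`. -/
theorem eventually_mem_fix_of_antitone {x : EuclideanSpace ℝ (Fin n)} (hx : Antitone x) :
    ∀ᶠ y in 𝓝 x, ∀ σ : Equiv.Perm (Fin n), Antitone (permute σ y) → σ ∈ fix x := by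
  refine eventually_all.2 fun σ => ?_
  by_cases hσ : permute σ x = x
  · exact Eventually.of_forall fun _ _ => hσ
  have hpos : 0 < ‖permute σ x - x‖ / 2 := half_pos (norm_pos_iff.2 (sub_ne_zero.2 hσ))
  filter_upwards [Metric.ball_mem_nhds x hpos] with y hy h
  rw [Metric.mem_ball, dist_eq_norm] at hy
  have h1 : (1 : Matrix (Fin n) (Fin n) ℝ) ∈ orthogonalGroup (Fin n) ℝ := one_mem _
  have e1 := norm_lam_sub_lam_le (conjDiag 1 y) (conjDiag 1 x)
  rw [(lam_conjDiag_and_mem_diagonalizers h1 h).1, lam_conjDiag h1 hx, ← conjDiag_sub,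
    norm_conjDiag h1] at e1
  have e2 : ‖permute σ x - permute σ y‖ = ‖y - x‖ := by
    rw [← permute_sub, norm_permute, norm_sub_rev]
  have e3 := norm_sub_le_norm_sub_add_norm_sub (permute σ x) (permute σ y) x
  linarith

end LocalSymmetry

/-! ### Limits of orthogonal diagonalizations. -/

section Compactness

variable {n : ℕ}

theorem tendsto_symMat_iff {ι : Type*} {l : Filter ι} {Xs : ι → SymMat n} {X : SymMat n} :
    Tendsto Xs l (𝓝 X) ↔ Tendsto (fun i => (Xs i : Matrix (Fin n) (Fin n) ℝ)) l
      (𝓝 (X : Matrix (Fin n) (Fin n) ℝ)) :=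
  -- The topology of the Frobenius norm is definitionally the one induced by the entrywise topology.
  (Topology.IsInducing.mk rfl : Topology.IsInducing
    (Subtype.val : SymMat n → Matrix (Fin n) (Fin n) ℝ)).tendsto_nhds_iff

theorem tendsto_conjDiag {ι : Type*} {l : Filter ι} {Us : ι → Matrix (Fin n) (Fin n) ℝ}
    {U : Matrix (Fin n) (Fin n) ℝ} {vs : ι → EuclideanSpace ℝ (Fin n)}
    {v : EuclideanSpace ℝ (Fin n)} (hU : Tendsto Us l (𝓝 U)) (hv : Tendsto vs l (𝓝 v)) :
    Tendsto (fun i => conjDiag (Us i) (vs i)) l (𝓝 (conjDiag U v)) := by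
  rw [tendsto_symMat_iff]
  have hc : Continuous fun p : Matrix (Fin n) (Fin n) ℝ × EuclideanSpace ℝ (Fin n) =>
      p.1ᵀ * diagonal (fun i => p.2 i) * p.1 := by
    fun_prop
  simp only [coe_conjDiag]
  have h := Tendsto.comp (hc.tendsto (U, v)) (hU.prodMk_nhds hv)
  exact h

theorem continuous_conjDiag (U : Matrix (Fin n) (Fin n) ℝ) : Continuous (conjDiag U) :=
  continuous_iff_continuousAt.2 fun _ => tendsto_conjDiag tendsto_const_nhds tendsto_id

theorem exists_subseq_tendsto_orthogonal {Us : ℕ → Matrix (Fin n) (Fin n) ℝ}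
    (hU : ∀ i, Us i ∈ orthogonalGroup (Fin n) ℝ) :
    ∃ W ∈ orthogonalGroup (Fin n) ℝ, ∃ φ : ℕ → ℕ, StrictMono φ ∧
      Tendsto (Us ∘ φ) atTop (𝓝 W) := by
  have hK : IsCompact (Set.univ.pi fun _ => Set.univ.pi fun _ => Set.Icc (-1) 1 :
      Set (Fin n → Fin n → ℝ)) :=
    isCompact_univ_pi fun _ => isCompact_univ_pi fun _ => isCompact_Icc
  obtain ⟨W, -, φ, hφ, hW⟩ := hK.tendsto_subseq (x := fun k i j => Us k i j) fun k i _ j _ =>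
    abs_le.1 (entry_norm_bound_of_unitary (hU k) i j)
  refine ⟨W, mem_orthogonalGroup_of_mul_transpose ?_, φ, hφ, hW⟩
  have hc : Continuous fun A : Matrix (Fin n) (Fin n) ℝ => A * Aᵀ := by fun_prop
  refine tendsto_nhds_unique ((hc.tendsto W).comp hW) (tendsto_const_nhds.congr fun k => ?_)
  exact (mul_transpose_self_of_mem (hU (φ k))).symm

/-- The vector is recovered continuously from the matrix, as the diagonal of `U * V * Uᵀ`. -/
theorem tendsto_of_tendsto_conjDiag {Us : ℕ → Matrix (Fin n) (Fin n) ℝ}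
    {U : Matrix (Fin n) (Fin n) ℝ} (hUs : ∀ i, Us i ∈ orthogonalGroup (Fin n) ℝ)
    {vs : ℕ → EuclideanSpace ℝ (Fin n)} {V : SymMat n} (hU : Tendsto Us atTop (𝓝 U))
    (hV : Tendsto (fun i => conjDiag (Us i) (vs i)) atTop (𝓝 V)) :
    ∃ v, Tendsto vs atTop (𝓝 v) ∧ V = conjDiag U v := by
  have hc : Continuous fun p : Matrix (Fin n) (Fin n) ℝ × Matrix (Fin n) (Fin n) ℝ =>
      WithLp.toLp 2 (diag (p.1 * p.2 * p.1ᵀ)) := by fun_prop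
  have hlim := (hc.tendsto (U, V)).comp (hU.prodMk_nhds (tendsto_symMat_iff.1 hV))
  have hv : Tendsto vs atTop (𝓝 (WithLp.toLp 2 (diag (U * V * Uᵀ)))) := by
    refine hlim.congr fun k => ?_
    have e := mul_transpose_self_of_mem (hUs k)
    have : Us k * (conjDiag (Us k) (vs k) : Matrix (Fin n) (Fin n) ℝ) * (Us k)ᵀ
        = diagonal fun i => vs k i := by
      calc _ = (Us k * (Us k)ᵀ) * (diagonal fun i => vs k i) * (Us k * (Us k)ᵀ) := by
            simp only [coe_conjDiag, Matrix.mul_assoc]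
        _ = _ := by rw [e, Matrix.one_mul, Matrix.mul_one]
    simp [this]
  exact ⟨_, hv, tendsto_nhds_unique hV (tendsto_conjDiag hU hv)⟩

end Compactness

/-! ### The subdifferential formula for `f ∘ lam`. -/

section SpectralSubdifferential

variable {n : ℕ} {f : EuclideanSpace ℝ (Fin n) → EReal}

/-- Collects what is needed to move `y` near `lam X` in the fixed frame `U`: sorting `y` takes a
permutation fixing `lam X`, under which `f` is invariant near `y`. -/
theorem eventually_exists_sorting {X : SymMat n} (hf : LocallySymmetric f (lam X))
    {U : Matrix (Fin n) (Fin n) ℝ} (hU : U ∈ orthogonalGroup (Fin n) ℝ) :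
    ∀ᶠ y in 𝓝 (lam X), ∃ σ ∈ fix (lam X), lam (conjDiag U y) = permute σ y ∧
      U.submatrix (σ⁻¹ : Equiv.Perm (Fin n)) id ∈ diagonalizers (conjDiag U y) ∧
      LocallySymmetric f (lam (conjDiag U y)) ∧ ∀ᶠ z in 𝓝 y, f z = f (permute σ z) := by
  have hlim : Tendsto (fun y => lam (conjDiag U y)) (𝓝 (lam X)) (𝓝 (lam X)) := by
    have h := (continuous_lam.comp (continuous_conjDiag U)).tendsto (lam X)
    rwa [Function.comp_apply, lam_conjDiag hU (antitone_lam X)] at h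
  filter_upwards [eventually_mem_fix_of_antitone (antitone_lam X), hlim.eventually hf.eventually,
    Eventually.eventually_nhds hf] with y h1 h2 h3
  obtain ⟨σ, hσ⟩ := exists_antitone_permute y
  obtain ⟨e1, e2⟩ := lam_conjDiag_and_mem_diagonalizers hU hσ
  exact ⟨σ, h1 σ hσ, e1, e2, h2, h3.mono fun z hz => hz σ (h1 σ hσ)⟩

theorem permute_mem_frechetSubdiff {σ : Equiv.Perm (Fin n)} {x v : EuclideanSpace ℝ (Fin n)}
    (h : ∀ᶠ y in 𝓝 x, f y = f (permute σ y)) (hv : v ∈ frechetSubdiff f x) :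
    permute σ v ∈ frechetSubdiff f (permute σ x) := by
  simp only [← permuteEquiv_apply] at h ⊢
  exact map_mem_frechetSubdiff _ h hv

theorem permute_mem_limitingSubdiff {σ : Equiv.Perm (Fin n)} {x v : EuclideanSpace ℝ (Fin n)}
    (h : ∀ᶠ y in 𝓝 x, f y = f (permute σ y)) (hv : v ∈ limitingSubdiff f x) :
    permute σ v ∈ limitingSubdiff f (permute σ x) := by
  simp only [← permuteEquiv_apply] at h ⊢
  exact map_mem_limitingSubdiff _ h hv

/-- The spectral map majorizes its directional derivatives, up to a quadratic error. -/
theorem mul_inner_conjDiag_sub_le {X Z : SymMat n} {U : Matrix (Fin n) (Fin n) ℝ}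
    (hU : U ∈ diagonalizers X) {t : ℝ} {v : EuclideanSpace ℝ (Fin n)} {σ : Equiv.Perm (Fin n)}
    (hσ : σ ∈ fix (lam X)) (ht : Antitone (permute σ (lam X + t • v))) :
    t * inner ℝ (conjDiag U v) (Z - X)
      ≤ t * inner ℝ (permute σ v) (lam Z - lam X) + ‖Z - X‖ ^ 2 / 2 := by
  have hX : conjDiag U (lam X) = X := hU.2.symm
  have hσ' : permute σ (lam X) = lam X := hσ
  have h1 : lam (X + t • conjDiag U v) = lam X + t • permute σ v := by
    conv_lhs => rw [← hX, ← conjDiag_smul, ← conjDiag_add]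
    rw [(lam_conjDiag_and_mem_diagonalizers hU.1 ht).1, permute_add, permute_smul, hσ']
  have h2 := inner_le_inner_lam (X + t • conjDiag U v) Z
  rw [h1, inner_add_left, inner_add_left, real_inner_smul_left, real_inner_smul_left] at h2
  have h3 : inner ℝ (conjDiag U v) X = inner ℝ v (lam X) := by
    conv_lhs => rw [← hX]
    exact inner_conjDiag hU.1 _ _
  have h4 : inner ℝ (permute σ v) (lam X) = inner ℝ v (lam X) := by
    conv_lhs => rw [← hσ']
    rw [← permuteEquiv_apply, ← permuteEquiv_apply, LinearIsometryEquiv.inner_map_map]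
  have h5 := norm_sub_sq_real Z X
  have h6 := norm_sub_sq_real (lam Z) (lam X)
  rw [norm_lam, norm_lam] at h6
  rw [inner_sub_right, inner_sub_right, h3, h4]
  rw [real_inner_comm] at h5 h6
  -- The error `⟨lam X, lam Z⟩ - ⟨X, Z⟩` equals half of `‖Z - X‖ ^ 2 - ‖lam Z - lam X‖ ^ 2`, because
  -- `lam` preserves norms.
  nlinarith [sq_nonneg ‖lam Z - lam X‖]

theorem conjDiag_mem_frechetSubdiff {X : SymMat n} (hf : LocallySymmetric f (lam X))
    {v : EuclideanSpace ℝ (Fin n)} (hv : v ∈ frechetSubdiff f (lam X))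
    {U : Matrix (Fin n) (Fin n) ℝ} (hU : U ∈ diagonalizers X) :
    conjDiag U v ∈ frechetSubdiff (f ∘ lam) X := by
  -- One sufficiently small `t` is enough; it stays fixed, and the quadratic error divided by `t` is
  -- at most `ε / 2 * ‖Z - X‖` on the ball of radius `ε * t`.
  obtain ⟨t, ht0, σ, hσ, ht⟩ : ∃ t : ℝ, 0 < t ∧ ∃ σ ∈ fix (lam X),
      Antitone (permute σ (lam X + t • v)) := by
    have hlim : Tendsto (fun t : ℝ => lam X + t • v) (𝓝[>] 0) (𝓝 (lam X)) := by
      have hc : Continuous fun t : ℝ => lam X + t • v := by fun_prop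
      simpa using (hc.tendsto 0).mono_left nhdsWithin_le_nhds
    obtain ⟨t, h1, h2⟩ := ((hlim.eventually
      (eventually_mem_fix_of_antitone (antitone_lam X))).and self_mem_nhdsWithin).exists
    obtain ⟨σ, hσ⟩ := exists_antitone_permute (lam X + t • v)
    exact ⟨t, h2, σ, h1 σ hσ, hσ⟩
  have hw : permute σ v ∈ frechetSubdiff f (lam X) := by
    have := permute_mem_frechetSubdiff (hf.mono fun y hy => hy σ hσ) hv
    rwa [show permute σ (lam X) = lam X from hσ] at this
  refine ⟨hv.1, hv.2.1, fun ε hε => ?_⟩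
  filter_upwards [(continuous_lam.tendsto X).eventually (hw.2.2 (ε / 2) (half_pos hε)),
    Metric.ball_mem_nhds X (mul_pos hε ht0)] with Z h1 h2
  refine le_trans (add_le_add_right (EReal.coe_le_coe_iff.2 ?_) _) h1
  rw [Metric.mem_ball, dist_eq_norm] at h2
  have h3 := mul_inner_conjDiag_sub_le (Z := Z) hU hσ ht
  have h4 : ‖Z - X‖ ^ 2 / 2 ≤ t * (ε / 2 * ‖Z - X‖) := by
    nlinarith [norm_nonneg (Z - X)]
  have h5 : inner ℝ (conjDiag U v) (Z - X)
      ≤ inner ℝ (permute σ v) (lam Z - lam X) + ε / 2 * ‖Z - X‖ := by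
    refine le_of_mul_le_mul_left ?_ ht0
    linarith
  nlinarith [norm_lam_sub_lam_le Z X]

/-- Sharing a frame with `X + t • V`, the matrix `Y = conjDiag W (lam X)` attains equality in the
trace inequality, so its inner product with `X + t • V` is at least that of `X`. As `‖Y‖ = ‖X‖`, the
term `⟨X, Y - X⟩` is `-‖Y - X‖ ^ 2 / 2`. -/
theorem norm_sq_conjDiag_lam_sub_le {X V : SymMat n} {t : ℝ} {W : Matrix (Fin n) (Fin n) ℝ}
    (hW : W ∈ diagonalizers (X + t • V)) :
    ‖conjDiag W (lam X) - X‖ ^ 2 / 2 ≤ t * inner ℝ V (conjDiag W (lam X) - X) := by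
  set Y := conjDiag W (lam X) with hY
  have h1 : inner ℝ Y (X + t • V) = inner ℝ (lam X) (lam (X + t • V)) := by
    conv_lhs => rw [hW.2]
    exact inner_conjDiag hW.1 _ _
  have h2 := inner_le_inner_lam X (X + t • V)
  have h3 : ‖Y‖ = ‖X‖ := by rw [hY, norm_conjDiag hW.1, norm_lam]
  rw [← h1, inner_add_right, inner_add_right, real_inner_smul_right, real_inner_smul_right,
    real_inner_self_eq_norm_sq] at h2
  rw [norm_sub_sq_real, h3, inner_sub_right, real_inner_comm V X, real_inner_comm V Y] at *
  linarith

/-- The point is that `V` and `X` are simultaneously diagonalizable. The matrices `Y k` have the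
spectrum of `X`, so `f ∘ lam` is constant on them and the subgradient inequality bounds `⟨V, Y k -
X⟩` by `o(‖Y k - X‖)`. With `key` this gives `‖Y k - X‖ = o(t k)`, so difference quotients of the
spectrum, conjugated by `W k`, tend to `V`. -/
theorem exists_conjDiag_of_mem_frechetSubdiff {X V : SymMat n}
    (hf : LocallySymmetric f (lam X)) (hV : V ∈ frechetSubdiff (f ∘ lam) X) :
    ∃ W ∈ diagonalizers X, ∃ v ∈ frechetSubdiff f (lam X), V = conjDiag W v := by
  obtain ⟨hb, htop, hε⟩ := hV
  set t : ℕ → ℝ := fun k => 1 / ((k : ℝ) + 1) with ht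
  have ht0 : ∀ k, 0 < t k := fun k => by positivity
  have htlim : Tendsto t atTop (𝓝 0) := tendsto_one_div_add_atTop_nhds_zero_nat
  choose W hW using fun k => diagonalizers_nonempty (X + t k • V)
  set Y : ℕ → SymMat n := fun k => conjDiag (W k) (lam X) with hY
  have key : ∀ k, ‖Y k - X‖ ^ 2 / 2 ≤ t k * inner ℝ V (Y k - X) := fun k =>
    norm_sq_conjDiag_lam_sub_le (hW k)
  have bound : ∀ k c, inner ℝ V (Y k - X) ≤ c * ‖Y k - X‖ → 0 ≤ c →
      ‖Y k - X‖ ≤ 2 * c * t k := by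
    intro k c h hc
    rcases (norm_nonneg (Y k - X)).eq_or_lt with h0 | h0
    · rw [← h0]; have := ht0 k; positivity
    · have h1 := (key k).trans (mul_le_mul_of_nonneg_left h (ht0 k).le)
      refine le_of_mul_le_mul_right ?_ h0
      linarith
  have hYX : Tendsto Y atTop (𝓝 X) := by
    refine tendsto_iff_norm_sub_tendsto_zero.2 ?_
    refine squeeze_zero (fun _ => norm_nonneg _)
      (fun k => bound k ‖V‖ (real_inner_le_norm _ _) (norm_nonneg _)) ?_
    simpa using htlim.const_mul (2 * ‖V‖)
  have hR : Tendsto (fun k => (t k)⁻¹ • (Y k - X)) atTop (𝓝 0) := by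
    refine tendsto_zero_iff_norm_tendsto_zero.2 (Metric.tendsto_atTop.2 fun ε hε0 => ?_)
    refine eventually_atTop.1 ?_
    filter_upwards [hYX.eventually (hε (ε / 4) (by positivity))] with k hk
    have hFY : (f ∘ lam) (Y k) = (f ∘ lam) X := by
      simp only [Function.comp_apply, hY, lam_conjDiag (hW k).1 (antitone_lam X)]
    rw [hFY] at hk
    lift (f ∘ lam) X to ℝ using ⟨htop, hb⟩ with r
    rw [← EReal.coe_add, EReal.coe_le_coe_iff] at hk
    have h1 := bound k (ε / 4) (by linarith) (by positivity)
    rw [norm_smul, norm_inv, Real.norm_of_nonneg (ht0 k).le, dist_zero_right, norm_mul, norm_inv,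
      Real.norm_of_nonneg (ht0 k).le, norm_norm, inv_mul_lt_iff₀ (ht0 k)]
    nlinarith [ht0 k]
  obtain ⟨W₀, hW₀, φ, hφ, hlim⟩ := exists_subseq_tendsto_orthogonal fun k => (hW k).1
  have hX : X = conjDiag W₀ (lam X) :=
    tendsto_nhds_unique (hYX.comp hφ.tendsto_atTop) (tendsto_conjDiag hlim tendsto_const_nhds)
  have hu : ∀ k, conjDiag (W k) ((t k)⁻¹ • (lam (X + t k • V) - lam X))
      = V - (t k)⁻¹ • (Y k - X) := by
    intro k
    rw [conjDiag_smul, conjDiag_sub, ← (hW k).2, eq_sub_iff_add_eq, ← smul_add]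
    have : X + t k • V - conjDiag (W k) (lam X) + (Y k - X) = t k • V := by
      simp only [hY]; abel
    rw [this, inv_smul_smul₀ (ht0 k).ne']
  have hVlim : Tendsto (fun k => conjDiag ((W ∘ φ) k)
      ((t (φ k))⁻¹ • (lam (X + t (φ k) • V) - lam X))) atTop (𝓝 V) := by
    simp only [Function.comp_apply, hu]
    simpa using tendsto_const_nhds.sub (hR.comp hφ.tendsto_atTop)
  obtain ⟨v, -, hVv⟩ := tendsto_of_tendsto_conjDiag (fun k => (hW (φ k)).1) hlim hVlim
  refine ⟨W₀, ⟨hW₀, hX⟩, v, ⟨hb, htop, fun ε hε0 => ?_⟩, hVv⟩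
  have hc : Tendsto (conjDiag W₀) (𝓝 (lam X)) (𝓝 X) := by
    have := (continuous_conjDiag W₀).tendsto (lam X)
    rwa [← hX] at this
  -- The subgradient inequality for `f ∘ lam` is restricted to matrices diagonal in the frame `W₀`,
  -- where the conjugation is isometric.
  filter_upwards [hc.eventually (hε ε hε0), eventually_exists_sorting hf hW₀] with y h1 h2
  obtain ⟨σ, -, e1, -, -, e2⟩ := h2
  have hfy : (f ∘ lam) (conjDiag W₀ y) = f y := by
    rw [Function.comp_apply, e1, e2.self_of_nhds]
  rw [hfy] at h1
  have e : conjDiag W₀ y - X = conjDiag W₀ (y - lam X) := by rw [conjDiag_sub, ← hX]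
  rwa [e, hVv, inner_conjDiag hW₀, norm_conjDiag hW₀] at h1

theorem conjDiag_mem_limitingSubdiff {X : SymMat n} (hf : LocallySymmetric f (lam X))
    {v : EuclideanSpace ℝ (Fin n)} (hv : v ∈ limitingSubdiff f (lam X))
    {U : Matrix (Fin n) (Fin n) ℝ} (hU : U ∈ diagonalizers X) :
    conjDiag U v ∈ limitingSubdiff (f ∘ lam) X := by
  obtain ⟨hb, ht, xs, vs, hF, hxs, hfxs, hvs⟩ := hv
  refine mem_limitingSubdiff_of_eventually (xs := fun i => conjDiag U (xs i))
    (vs := fun i => conjDiag U (vs i)) hb ht ?_ ?_ ?_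
    (((continuous_conjDiag U).tendsto v).comp hvs)
  · filter_upwards [hxs.eventually (eventually_exists_sorting hf hU.1)] with i hi
    obtain ⟨σ, -, e1, e2, e3, e4⟩ := hi
    rw [← conjDiag_submatrix U σ (vs i)]
    refine conjDiag_mem_frechetSubdiff e3 ?_ e2
    rw [e1]
    exact permute_mem_frechetSubdiff e4 (hF i)
  · have := ((continuous_conjDiag U).tendsto (lam X)).comp hxs
    rwa [← hU.2] at this
  · refine hfxs.congr' ?_
    filter_upwards [hxs.eventually (eventually_exists_sorting hf hU.1)] with i hi
    obtain ⟨σ, -, e1, -, -, e4⟩ := hi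
    rw [Function.comp_apply, e1, e4.self_of_nhds]

theorem exists_conjDiag_of_mem_limitingSubdiff {X V : SymMat n}
    (hf : LocallySymmetric f (lam X)) (hV : V ∈ limitingSubdiff (f ∘ lam) X) :
    ∃ W ∈ diagonalizers X, ∃ v ∈ limitingSubdiff f (lam X), V = conjDiag W v := by
  obtain ⟨hb, ht, Xs, Vs, hF, hXs, hfXs, hVs⟩ := hV
  have hlam : Tendsto (fun i => lam (Xs i)) atTop (𝓝 (lam X)) :=
    (continuous_lam.tendsto X).comp hXs
  obtain ⟨N, hN⟩ := eventually_atTop.1 (hlam.eventually hf.eventually)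
  choose W hW v hv hVv using fun i =>
    exists_conjDiag_of_mem_frechetSubdiff (hN (i + N) (Nat.le_add_left _ _)) (hF (i + N))
  obtain ⟨W₀, hW₀, φ, hφ, hlim⟩ := exists_subseq_tendsto_orthogonal fun k => (hW k).1
  have hshift : Tendsto (fun k => φ k + N) atTop atTop :=
    (tendsto_add_atTop_nat N).comp hφ.tendsto_atTop
  have hVlim : Tendsto (fun k => conjDiag ((W ∘ φ) k) (v (φ k))) atTop (𝓝 V) :=
    (hVs.comp hshift).congr fun k => hVv (φ k)
  obtain ⟨v₀, hv₀, rfl⟩ := tendsto_of_tendsto_conjDiag (fun k => (hW (φ k)).1) hlim hVlim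
  have hX : X = conjDiag W₀ (lam X) :=
    tendsto_nhds_unique ((hXs.comp hshift).congr fun k => (hW (φ k)).2)
      (tendsto_conjDiag hlim (hlam.comp hshift))
  exact ⟨W₀, ⟨hW₀, hX⟩, v₀, ⟨hb, ht, fun k => lam (Xs (φ k + N)), fun k => v (φ k),
    fun k => hv (φ k), hlam.comp hshift, hfXs.comp hshift, hv₀⟩, rfl⟩

/-! ### Transfer of identifiability. -/

/-- Two pairs of simultaneously diagonal matrices that are orthogonally conjugate differ by a
permutation of the coordinates. -/
theorem exists_permute_of_conjDiag_eq {U W : Matrix (Fin n) (Fin n) ℝ}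
    (hU : U ∈ orthogonalGroup (Fin n) ℝ) (hW : W ∈ orthogonalGroup (Fin n) ℝ)
    {x v w : EuclideanSpace ℝ (Fin n)} (hx : conjDiag W x = conjDiag U x)
    (hv : conjDiag W w = conjDiag U v) : ∃ σ ∈ fix x, permute σ w = v := by
  -- The matrix `U * Wᵀ` intertwines the two diagonals, so each nonzero entry forces equal diagonal
  -- values.
  have key : ∀ a b : EuclideanSpace ℝ (Fin n), conjDiag W a = conjDiag U b →
      ∀ i j, (U * Wᵀ) i j ≠ 0 → a j = b i := by
    intro a b h i j hij
    have h1 := congrArg Subtype.val h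
    rw [coe_conjDiag, coe_conjDiag] at h1
    have h2 : (U * Wᵀ) * diagonal (fun i => a i) = diagonal (fun i => b i) * (U * Wᵀ) := by
      calc _ = U * (Wᵀ * diagonal (fun i => a i) * W) * Wᵀ := by
            rw [← Matrix.mul_one (U * Wᵀ * diagonal fun i => a i), ← mul_transpose_self_of_mem hW]
            simp only [Matrix.mul_assoc]
        _ = (U * Uᵀ) * diagonal (fun i => b i) * (U * Wᵀ) := by
            rw [h1]; simp only [Matrix.mul_assoc]
        _ = _ := by rw [mul_transpose_self_of_mem hU, Matrix.one_mul]
    have h3 := congrFun (congrFun h2 i) j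
    rw [mul_diagonal, diagonal_mul, mul_comm] at h3
    exact mul_right_cancel₀ hij h3
  have hdet : (U * Wᵀ).det ≠ 0 := by
    have h1 : (U * Wᵀ) * (W * Uᵀ) = 1 := by
      rw [Matrix.mul_assoc, ← Matrix.mul_assoc Wᵀ, transpose_mul_self_of_mem hW, Matrix.one_mul,
        mul_transpose_self_of_mem hU]
    have h2 := congrArg det h1
    rw [det_mul, det_one] at h2
    exact left_ne_zero_of_mul_eq_one h2
  -- A nonzero term in the Leibniz expansion is a permutation along which every entry is nonzero. It
  -- depends only on `U` and `W`, so it serves both pairs at once.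
  rw [det_apply] at hdet
  obtain ⟨σ, -, hσ⟩ := Finset.exists_ne_zero_of_sum_ne_zero hdet
  have hne : ∀ i, (U * Wᵀ) (σ i) i ≠ 0 := by
    intro i hi
    refine hσ ?_
    have h0 : ∏ i, (U * Wᵀ) (σ i) i = 0 := Finset.prod_eq_zero (Finset.mem_univ i) hi
    exact (congrArg _ h0).trans (smul_zero _)
  have perm : ∀ a b : EuclideanSpace ℝ (Fin n), conjDiag W a = conjDiag U b →
      permute σ a = b := by
    intro a b h
    ext i
    rw [permute_apply]
    refine key a b h i _ ?_
    simpa using hne (σ⁻¹ i)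
  exact ⟨σ, perm x x hx, perm w v hv⟩

theorem IsIdentifiable.of_lam_preimage {X : SymMat n} (hf : LocallySymmetric f (lam X))
    {M : Set (EuclideanSpace ℝ (Fin n))} (hMdom : M ⊆ dom f)
    (hM : LocallySymmetricSet M (lam X)) {v : EuclideanSpace ℝ (Fin n)}
    (hv : v ∈ limitingSubdiff f (lam X)) {U : Matrix (Fin n) (Fin n) ℝ}
    (hU : U ∈ diagonalizers X)
    (h : IsIdentifiable (f ∘ lam) (lam ⁻¹' M) X (conjDiag U v)) :
    IsIdentifiable f M (lam X) v := by
  refine ⟨hMdom, hv, fun xs vs hF hxs hfxs hvs => ?_⟩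
  have hsort := hxs.eventually (eventually_exists_sorting hf hU.1)
  have hmem := h.eventually_mem (xs := fun i => conjDiag U (xs i))
    (vs := fun i => conjDiag U (vs i)) ?_ ?_ ?_ (((continuous_conjDiag U).tendsto v).comp hvs)
  -- The sorting permutation varies with `i` but always fixes `lam X`, so membership in `M` passes
  -- back to `xs i`.
  · filter_upwards [hmem, hsort, hxs.eventually hM.eventually_mem_iff] with i h1 h2 h3
    obtain ⟨σ, hσ, e1, -⟩ := h2
    rwa [Set.mem_preimage, e1, h3 σ hσ] at h1
  · filter_upwards [hsort] with i hi
    obtain ⟨σ, -, e1, e2, e3, e4⟩ := hi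
    rw [← conjDiag_submatrix U σ (vs i)]
    refine conjDiag_mem_limitingSubdiff e3 ?_ e2
    rw [e1]
    exact permute_mem_limitingSubdiff e4 (hF i)
  · have := ((continuous_conjDiag U).tendsto (lam X)).comp hxs
    rwa [← hU.2] at this
  · refine hfxs.congr' ?_
    filter_upwards [hsort] with i hi
    obtain ⟨σ, -, e1, -, -, e4⟩ := hi
    rw [Function.comp_apply, e1, e4.self_of_nhds]

theorem IsIdentifiable.lam_preimage {X : SymMat n} (hf : LocallySymmetric f (lam X))
    {M : Set (EuclideanSpace ℝ (Fin n))} (hM : LocallySymmetricSet M (lam X))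
    {v : EuclideanSpace ℝ (Fin n)} {U : Matrix (Fin n) (Fin n) ℝ} (hU : U ∈ diagonalizers X)
    (h : IsIdentifiable f M (lam X) v) :
    IsIdentifiable (f ∘ lam) (lam ⁻¹' M) X (conjDiag U v) := by
  refine ⟨fun Z hZ => h.1 hZ, conjDiag_mem_limitingSubdiff hf h.2.1 hU,
    fun Xs Vs hF hXs hfXs hVs => ?_⟩
  have hlam : Tendsto (fun i => lam (Xs i)) atTop (𝓝 (lam X)) :=
    (continuous_lam.tendsto X).comp hXs
  by_contra hcon
  -- Passing to a subsequence lying wholly outside the preimage of `M` leaves freedom to extract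
  -- further; one term inside it then gives the contradiction.
  obtain ⟨ψ, hψ, hψ'⟩ := extraction_of_frequently_atTop
    ((not_eventually.1 hcon).and_eventually (hlam.eventually hf.eventually))
  choose W hW w hw hVw using fun k =>
    exists_conjDiag_of_mem_limitingSubdiff (hψ' k).2 (hF (ψ k))
  obtain ⟨W₀, hW₀, φ, hφ, hlim⟩ := exists_subseq_tendsto_orthogonal fun k => (hW k).1
  have hshift : Tendsto (fun k => ψ (φ k)) atTop atTop :=
    hψ.tendsto_atTop.comp hφ.tendsto_atTop
  have hVlim : Tendsto (fun k => conjDiag ((W ∘ φ) k) (w (φ k))) atTop (𝓝 (conjDiag U v)) :=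
    (hVs.comp hshift).congr fun k => hVw (φ k)
  obtain ⟨w₀, hw₀, hVw₀⟩ := tendsto_of_tendsto_conjDiag (fun k => (hW (φ k)).1) hlim hVlim
  have hX : X = conjDiag W₀ (lam X) :=
    tendsto_nhds_unique ((hXs.comp hshift).congr fun k => (hW (φ k)).2)
      (tendsto_conjDiag hlim (hlam.comp hshift))
  -- The limit `w₀` need not be `v`, only a permutation of it, so the hypothesis is applied to the
  -- sequences permuted by `σ`.
  obtain ⟨σ, hσ, rfl⟩ := exists_permute_of_conjDiag_eq hU.1 hW₀ (hX.symm.trans hU.2) hVw₀.symm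
  have hxs := hlam.comp hshift
  have hxσ : Tendsto (fun k => permute σ (lam (Xs (ψ (φ k))))) atTop (𝓝 (lam X)) := by
    have := ((continuous_permute σ).tendsto (lam X)).comp hxs
    rwa [show permute σ (lam X) = lam X from hσ] at this
  have hmem := h.eventually_mem (vs := fun k => permute σ (w (φ k))) ?_ hxσ ?_
    (((continuous_permute σ).tendsto w₀).comp hw₀)
  · obtain ⟨k, h1, h2⟩ := (hmem.and (hxs.eventually hM.eventually_mem_iff)).exists
    exact (hψ' (φ k)).1 ((h2 σ hσ).1 h1)
  · filter_upwards [hxs.eventually (Eventually.eventually_nhds hf)] with k hk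
    exact permute_mem_limitingSubdiff (hk.mono fun y hy => hy σ hσ) (hw (φ k))
  · refine (hfXs.comp hshift).congr' ?_
    filter_upwards [hxs.eventually hf] with k hk using hk σ hσ

end SpectralSubdifferential

end SpectralLift

theorem proposition3p9 (n : ℕ) (f : EuclideanSpace ℝ (Fin n) → EReal)
    (hf : LowerSemicontinuous f) (X₀ : SpectralLift.SymMat n)
    (hfsymm : SpectralLift.LocallySymmetric f (SpectralLift.lam X₀))
    (M : Set (EuclideanSpace ℝ (Fin n))) (hMdom : M ⊆ SpectralLift.dom f)
    (hMsymm : SpectralLift.LocallySymmetricSet M (SpectralLift.lam X₀))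
    (v : EuclideanSpace ℝ (Fin n))
    (hv : v ∈ SpectralLift.limitingSubdiff f (SpectralLift.lam X₀))
    (U : Matrix (Fin n) (Fin n) ℝ) (hU : U ∈ SpectralLift.diagonalizers X₀) :
    SpectralLift.conjDiag U v ∈
        SpectralLift.limitingSubdiff (f ∘ SpectralLift.lam) X₀ ∧
      (SpectralLift.IsIdentifiable f M (SpectralLift.lam X₀) v ↔
        SpectralLift.IsIdentifiable (f ∘ SpectralLift.lam) (SpectralLift.lam ⁻¹' M) X₀
          (SpectralLift.conjDiag U v)) :=
  ⟨SpectralLift.conjDiag_mem_limitingSubdiff hfsymm hv hU,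
    fun h => h.lam_preimage hfsymm hMsymm hU,
    fun h => h.of_lam_preimage hfsymm hMdom hMsymm hv hU⟩
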